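/- Let $n\ge 1$ and let $\mathcal K=\{x\in\mathbb R^n:\ a_i^\top x\le b_i,\ i=1,\dots,p\}$ (with $p \ge 0$ and $\|a_i\|=1$) be a polyhedron with $0$ in its interior. Let $\ell,\mu,R,\beta>0$ and $\varsigma\ge 0$. Let $z$ be a random variable with values in a set $\mathcal Z$ and let $f:\mathbb R^n\times\mathcal Z\to\mathbb R$ be such that, for every $s\in\mathcal Z$, $f(\cdot,s)$ is differentiable and $\nabla_x f(\cdot,s)$ is $\ell$-Lipschitz on $\mathbb R^n$, and such that $f(x,z)$ is integrable for every $x$. Put $\bar f(x)=\mathbb E[f(x,z)]$ and assume that $\bar f$ is $\mu$-strongly convex outside a ball of radius $R$, i.e. $$(x_1-x_2)^\top\big(\nabla\bar f(x_1)-\nabla\bar f(x_2)\big)\ \ge\ \mu\|x_1-x_2\|^2\qquad\text{for all }x_1,x_2\in\mathcal K\text{ with }\|x_1-x_2\|\ge R .$$ (In the application to Langevin algorithms, $z$ has the common law of a stationary data process and $\varsigma$ is an upper bound on the second moment of the initial state.) Define $$\pi_{\beta\bar f}(A)=\frac{\int_{A\cap\mathcal K}e^{-\beta\bar f(x)}\,dx}{\int_{\mathcal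 K}e^{-\beta\bar f(x)}\,dx},\qquad c_L=(\ell+\mu)R^2+R\|\nabla\bar f(0)\|+\frac n\beta,$$ $$d=\ell\max\Big\{R,\tfrac{\|\nabla\bar f(0)\|}{\mu}\Big\}+\|\nabla\bar f(0)\|,\qquad \epsilon=-\frac1\ell d+\frac1\ell\sqrt{d^2+\frac{2\ell\log 2}{\beta}} .$$ For $x\in\mathcal K$ let $\rho(x)$ be the Chebyshev radius of $\mathcal K\cap \mathcal B_x(\epsilon)$, i.e. the supremum of the radii of the balls contained in the intersection of $\mathcal K$ and the closed ball of radius $\epsilon$ centered at $x$. Then $\pi_{\beta\bar f}$ is a well-defined probability measure, $\bar f$ is $\pi_{\beta\bar f}$-integrable and attains its minimum over $\mathcal K$, and there is $r_{\min}>0$ with $\rho(x)\ge r_{\min}$ for all $x\in\mathcal K$. For every such $r_{\min}$, the constant $$c=\log n+2\log\Big(1+\frac1\mu c_L\Big)+\frac16\log 3+\log(2\sqrt\pi)-\log r_{\min}$$ is positive, and if $\mathbf x$ is drawn according to $\pi_{\beta\bar f}$, then $$\mathbb E[\bar f(\mathbf x)]\ \le\ \min_{x\in\mathcal K}\bar f(x)+\frac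 n\beta\big(2\max\{0,\log\varsigma\}+c\big),$$ with the convention $\max\{0,\log 0\}=0$. -/

import Mathlib

open MeasureTheory

noncomputable section

/-- A polyhedron: the solution set of finitely many inequalities `⟪a i, x⟫ ≤ b i` with unit
normals `a i` (no inequality at all gives the whole space). -/
def IsPolyhedron {n : ℕ} (K : Set (EuclideanSpace ℝ (Fin n))) : Prop :=
  ∃ (p : ℕ) (a : Fin p → EuclideanSpace ℝ (Fin n)) (b : Fin p → ℝ),
    (∀ i, ‖a i‖ = 1) ∧ K = {x | ∀ i, inner ℝ (a i) x ≤ b i}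

/-- The averaged objective `x ↦ 𝔼[f(x, z)]`. -/
def averagedObjective {n : ℕ} {Ω Z : Type*} [MeasurableSpace Ω] (P : Measure Ω) (z : Ω → Z)
    (f : EuclideanSpace ℝ (Fin n) → Z → ℝ) (x : EuclideanSpace ℝ (Fin n)) : ℝ :=
  ∫ ω, f x (z ω) ∂P

/-- The Gibbs measure on `K`: Lebesgue measure restricted to `K`, with density
`exp (-β g x) / ∫ y in K, exp (-β g y)`. -/
def gibbsMeasure {n : ℕ} (K : Set (EuclideanSpace ℝ (Fin n))) (β : ℝ)
    (g : EuclideanSpace ℝ (Fin n) → ℝ) : Measure (EuclideanSpace ℝ (Fin n)) :=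
  (volume.restrict K).tilted (fun x => -β * g x)

/-- `g` is `μ`-strongly convex on `K` outside a ball of radius `R`. -/
def StronglyConvexOutsideBall {n : ℕ} (K : Set (EuclideanSpace ℝ (Fin n))) (μ R : ℝ)
    (g : EuclideanSpace ℝ (Fin n) → ℝ) : Prop :=
  ∀ x₁ ∈ K, ∀ x₂ ∈ K, R ≤ ‖x₁ - x₂‖ →
    μ * ‖x₁ - x₂‖ ^ 2 ≤ inner ℝ (x₁ - x₂) (gradient g x₁ - gradient g x₂)

/-- The Lyapunov constant `(ℓ + μ) R² + R ‖∇g(0)‖ + n / β`. -/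
def lyapunovConst {n : ℕ} (ℓ μ R β : ℝ) (g : EuclideanSpace ℝ (Fin n) → ℝ) : ℝ :=
  (ℓ + μ) * R ^ 2 + R * ‖gradient g 0‖ + n / β

/-- The constant `d = ℓ max {R, ‖∇g(0)‖ / μ} + ‖∇g(0)‖`. -/
def gradBound {n : ℕ} (ℓ μ R : ℝ) (g : EuclideanSpace ℝ (Fin n) → ℝ) : ℝ :=
  ℓ * max R (‖gradient g 0‖ / μ) + ‖gradient g 0‖

/-- The localization radius `ε = -(1 / ℓ) d + (1 / ℓ) √(d² + 2 ℓ (1 / β) log 2)`. -/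
def localRadius {n : ℕ} (ℓ μ R β : ℝ) (g : EuclideanSpace ℝ (Fin n) → ℝ) : ℝ :=
  -(1 / ℓ) * gradBound ℓ μ R g
    + 1 / ℓ * Real.sqrt (gradBound ℓ μ R g ^ 2 + 2 * ℓ * (1 / β) * Real.log 2)

/-- The Chebyshev radius of `K ∩ B(x, ε)`: the supremum of the radii of the balls inscribed
in this set. -/
def chebyshevRadius {n : ℕ} (K : Set (EuclideanSpace ℝ (Fin n))) (ε : ℝ)
    (x : EuclideanSpace ℝ (Fin n)) : ℝ :=
  sSup {r : ℝ | 0 ≤ r ∧ ∃ y, Metric.closedBall y r ⊆ K ∩ Metric.closedBall x ε}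

/-- `r` is a positive lower bound, uniform over `x ∈ K`, for the Chebyshev radii of
`K ∩ B(x, ε)`. -/
def IsUniformChebyshevBound {n : ℕ} (K : Set (EuclideanSpace ℝ (Fin n))) (ε r : ℝ) : Prop :=
  0 < r ∧ ∀ x ∈ K, r ≤ chebyshevRadius K ε x

/-- The constant
`log n + 2 log (1 + L / μ) + (1/6) log 3 + log (2 √π) - log r`, `L` the Lyapunov constant. -/
def suboptConst {n : ℕ} (ℓ μ R β r : ℝ) (g : EuclideanSpace ℝ (Fin n) → ℝ) : ℝ :=
  Real.log n + 2 * Real.log (1 + 1 / μ * lyapunovConst ℓ μ R β g) + 1 / 6 * Real.log 3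
    + Real.log (2 * Real.sqrt Real.pi) - Real.log r

end

/-! Write `g` for the averaged objective, `w` for a minimiser of `g` on `K`, and `Z` for the
integral of `exp (-β g)` over `K`. Everything rests on the Gibbs variational inequality (Jensen for
`exp`): for any competitor `ψ`, the mean of `ψ + β g` under the Gibbs measure is at most `log ∫ exp
ψ - log Z`. It is used twice.

With a Gaussian competitor centred at `w` it bounds `β 𝔼[g] + log Z` by the second moment about `w`
and a Gaussian normalisation. With the competitor `-β g` composed with a homothety of ratio `λ < 1`
towards `w`, it bounds the mean decrease of `g` under this contraction, since convexity keeps the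
image inside `K` and the change of variables costs only `λ⁻ⁿ`. Dividing by `1 - λ` and letting `λ →
1` yields the second moment bound without any boundary integral.

It remains to bound `Z` from below. On the ball of radius `localRadius` about `w`, `g` exceeds its
minimum by at most `log 2 / β`, and the part of this ball in `K` contains a Euclidean ball of nearly
the Chebyshev radius, whose volume is explicit. A uniform positive Chebyshev bound exists because a
polyhedron has only finitely many patterns of nearly active constraints. -/

/-! ### Quadratic Taylor bounds for functions with Lipschitz gradient. -/

section LipschitzGradient

variable {E : Type*} [NormedAddCommGroup E] [InnerProductSpace ℝ E] [CompleteSpace E]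

theorem hasDerivAt_comp_line {g : E → ℝ} (hd : Differentiable ℝ g) (x v : E) (t : ℝ) :
    HasDerivAt (fun s : ℝ => g (x + s • v)) (inner ℝ (gradient g (x + t • v)) v) t := by
  have h1 : HasDerivAt (fun s : ℝ => x + s • v) v t := by
    simpa using ((hasDerivAt_id t).smul_const v).const_add x
  have h2 := (hd (x + t • v)).hasFDerivAt.comp_hasDerivAt t h1
  rwa [← inner_gradient_left] at h2

theorem le_add_inner_add_sq_of_lipschitz_gradient {g : E → ℝ} {ℓ : ℝ}
    (hd : Differentiable ℝ g)
    (hl : ∀ x y, ‖gradient g x - gradient g y‖ ≤ ℓ * ‖x - y‖) (x y : E) :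
    g y ≤ g x + inner ℝ (gradient g x) (y - x) + ℓ / 2 * ‖y - x‖ ^ 2 := by
  set v := y - x with hv
  -- Up to the constant `g x`, `φ` is the quadratic upper model minus `g` along the segment; the
  -- Lipschitz bound makes its derivative nonnegative.
  let φ : ℝ → ℝ := fun t => t * inner ℝ (gradient g x) v + ℓ / 2 * ‖v‖ ^ 2 * t ^ 2
    - g (x + t • v)
  have hφ : ∀ t, HasDerivAt φ
      (inner ℝ (gradient g x) v + ℓ * ‖v‖ ^ 2 * t - inner ℝ (gradient g (x + t • v)) v) t := by
    intro t
    have h := (((hasDerivAt_id t).mul_const (inner ℝ (gradient g x) v)).add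
      (((hasDerivAt_pow 2 t).const_mul (ℓ / 2 * ‖v‖ ^ 2)))).sub (hasDerivAt_comp_line hd x v t)
    convert! h using 1
    simp
    ring
  have hmono : MonotoneOn φ (Set.Icc 0 1) := by
    refine monotoneOn_of_deriv_nonneg (convex_Icc 0 1)
      (fun t _ => (hφ t).continuousAt.continuousWithinAt)
      (fun t _ => (hφ t).differentiableAt.differentiableWithinAt) fun t ht => ?_
    rw [interior_Icc] at ht
    rw [(hφ t).deriv]
    have h1 := real_inner_le_norm (gradient g (x + t • v) - gradient g x) v
    have h2 := hl (x + t • v) x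
    rw [add_sub_cancel_left, norm_smul, Real.norm_of_nonneg ht.1.le] at h2
    rw [inner_sub_left] at h1
    nlinarith [mul_le_mul_of_nonneg_right h2 (norm_nonneg v)]
  have := hmono (Set.left_mem_Icc.2 zero_le_one) (Set.right_mem_Icc.2 zero_le_one) zero_le_one
  have hxy : x + v = y := by simp [hv]
  simp only [φ, zero_mul, zero_smul, add_zero, one_mul, one_smul, one_pow, mul_one, hxy] at this
  linarith

theorem add_inner_sub_sq_le_of_lipschitz_gradient {g : E → ℝ} {ℓ : ℝ}
    (hd : Differentiable ℝ g)
    (hl : ∀ x y, ‖gradient g x - gradient g y‖ ≤ ℓ * ‖x - y‖) (x y : E) :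
    g x + inner ℝ (gradient g x) (y - x) - ℓ / 2 * ‖y - x‖ ^ 2 ≤ g y := by
  have hneg : ∀ x, gradient (fun x => -g x) x = -gradient g x := fun x => by
    have h := (hd x).hasGradientAt.hasFDerivAt.neg
    rw [← map_neg] at h
    exact (hasFDerivAt_iff_hasGradientAt.1 h).gradient.trans
      (LinearIsometryEquiv.symm_apply_apply _ _)
  have := le_add_inner_add_sq_of_lipschitz_gradient (g := fun x => -g x) (ℓ := ℓ) hd.neg
    (fun x y => by
      rw [hneg, hneg, neg_sub_neg, norm_sub_rev]
      exact hl x y) x y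
  rw [hneg, inner_neg_left] at this
  linarith

theorem abs_sub_sub_inner_le_of_lipschitz_gradient {g : E → ℝ} {ℓ : ℝ}
    (hd : Differentiable ℝ g)
    (hl : ∀ x y, ‖gradient g x - gradient g y‖ ≤ ℓ * ‖x - y‖) (x y : E) :
    |g y - g x - inner ℝ (gradient g x) (y - x)| ≤ ℓ / 2 * ‖y - x‖ ^ 2 := by
  rw [abs_le]
  constructor
  · linarith [add_inner_sub_sq_le_of_lipschitz_gradient hd hl x y]
  · linarith [le_add_inner_add_sq_of_lipschitz_gradient hd hl x y]

theorem hasGradientAt_of_abs_sub_sub_inner_le {g : E → ℝ} {c : ℝ} {x v : E}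
    (h : ∀ y, |g y - g x - inner ℝ v (y - x)| ≤ c * ‖y - x‖ ^ 2) : HasGradientAt g v x := by
  rw [hasGradientAt_iff_isLittleO]
  refine (Asymptotics.IsBigO.of_bound c (Filter.Eventually.of_forall fun y => ?_)).trans_isLittleO
    (Asymptotics.isLittleO_pow_sub_sub x one_lt_two)
  simpa using h y

end LipschitzGradient

/-! ### Regularity of the averaged objective. -/

section AveragedObjective

variable {n : ℕ} {Ω Z : Type*} [MeasurableSpace Ω] {P : Measure Ω} [IsProbabilityMeasure P]
  {z : Ω → Z} {f : EuclideanSpace ℝ (Fin n) → Z → ℝ} {ℓ : ℝ}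

theorem integrable_inner_gradient (hdiff : ∀ s : Z, Differentiable ℝ (fun x => f x s))
    (hlip : ∀ (s : Z) (x₁ x₂ : EuclideanSpace ℝ (Fin n)),
      ‖gradient (fun x => f x s) x₁ - gradient (fun x => f x s) x₂‖ ≤ ℓ * ‖x₁ - x₂‖)
    (hint : ∀ x, Integrable (fun ω => f x (z ω)) P) (x v : EuclideanSpace ℝ (Fin n)) :
    Integrable (fun ω => inner ℝ (gradient (fun x => f x (z ω)) x) v) P := by
  have hmeas : AEStronglyMeasurable (fun ω => inner ℝ (gradient (fun x => f x (z ω)) x) v) P := by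
    -- `Z` carries no measurable structure, so measurability is inherited from the difference
    -- quotients with step `1 / (k + 1)`.
    refine aestronglyMeasurable_of_tendsto_ae Filter.atTop
      (f := fun (k : ℕ) ω => ((k : ℝ) + 1) * (f (x + (1 / ((k : ℝ) + 1)) • v) (z ω) - f x (z ω)))
      (fun k => (((hint _).sub (hint x)).const_mul _).aestronglyMeasurable)
      (Filter.Eventually.of_forall fun ω => ?_)
    have h := (hasDerivAt_comp_line (hdiff (z ω)) x v 0).tendsto_slope_zero
    have hk : Filter.Tendsto (fun k : ℕ => 1 / ((k : ℝ) + 1)) Filter.atTop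
        (nhdsWithin 0 {0}ᶜ) :=
      tendsto_nhdsWithin_iff.2 ⟨tendsto_one_div_add_atTop_nhds_zero_nat,
        Filter.Eventually.of_forall fun k => (Nat.one_div_pos_of_nat (α := ℝ)).ne'⟩
    have h' := h.comp hk
    simp only [zero_smul, add_zero, zero_add] at h'
    refine h'.congr fun k => ?_
    simp
  have hb : ∀ ω, |inner ℝ (gradient (fun x => f x (z ω)) x) v| ≤
      |f (x + v) (z ω) - f x (z ω)| + ℓ / 2 * ‖v‖ ^ 2 := fun ω => by
    have h := abs_sub_sub_inner_le_of_lipschitz_gradient (hdiff (z ω)) (hlip (z ω)) x (x + v)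
    rw [add_sub_cancel_left] at h
    have h2 := abs_sub_abs_le_abs_sub (inner ℝ (gradient (fun x => f x (z ω)) x) v)
      (f (x + v) (z ω) - f x (z ω))
    rw [abs_sub_comm _ (f (x + v) (z ω) - f x (z ω))] at h2
    linarith
  exact Integrable.mono' (((hint (x + v)).sub (hint x)).abs.add (integrable_const _)) hmeas
    (Filter.Eventually.of_forall hb)

theorem integrable_gradient (hdiff : ∀ s : Z, Differentiable ℝ (fun x => f x s))
    (hlip : ∀ (s : Z) (x₁ x₂ : EuclideanSpace ℝ (Fin n)),
      ‖gradient (fun x => f x s) x₁ - gradient (fun x => f x s) x₂‖ ≤ ℓ * ‖x₁ - x₂‖)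
    (hint : ∀ x, Integrable (fun ω => f x (z ω)) P) (x : EuclideanSpace ℝ (Fin n)) :
    Integrable (fun ω => gradient (fun x => f x (z ω)) x) P := by
  let b := EuclideanSpace.basisFun (Fin n) ℝ
  have h : (fun ω => gradient (fun x => f x (z ω)) x) = fun ω =>
      ∑ i, (inner ℝ (gradient (fun x => f x (z ω)) x) (b i)) • b i := by
    funext ω
    conv_lhs => rw [← b.sum_repr' (gradient (fun x => f x (z ω)) x)]
    simp_rw [real_inner_comm]
  rw [h]
  exact integrable_finsetSum _ fun i _ =>
    (integrable_inner_gradient hdiff hlip hint x (b i)).smul_const _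

/-- The Taylor remainder of each `f (·, s)` is at most `ℓ / 2 * ‖y - x‖ ^ 2` uniformly in `s`. This
bound survives integration and already forces differentiability of the average. -/
theorem hasGradientAt_averagedObjective (hdiff : ∀ s : Z, Differentiable ℝ (fun x => f x s))
    (hlip : ∀ (s : Z) (x₁ x₂ : EuclideanSpace ℝ (Fin n)),
      ‖gradient (fun x => f x s) x₁ - gradient (fun x => f x s) x₂‖ ≤ ℓ * ‖x₁ - x₂‖)
    (hint : ∀ x, Integrable (fun ω => f x (z ω)) P) (x : EuclideanSpace ℝ (Fin n)) :
    HasGradientAt (averagedObjective P z f) (∫ ω, gradient (fun x => f x (z ω)) x ∂P) x := by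
  refine hasGradientAt_of_abs_sub_sub_inner_le (c := ℓ / 2) fun y => ?_
  have h1 : averagedObjective P z f y - averagedObjective P z f x
      - inner ℝ (∫ ω, gradient (fun x => f x (z ω)) x ∂P) (y - x)
      = ∫ ω, (f y (z ω) - f x (z ω)
        - inner ℝ (gradient (fun x => f x (z ω)) x) (y - x)) ∂P := by
    have h2 := integral_sub ((hint y).sub (hint x))
      (integrable_inner_gradient hdiff hlip hint x (y - x))
    simp only [Pi.sub_apply] at h2
    rw [h2, integral_sub (hint y) (hint x), real_inner_comm,
      ← integral_inner (integrable_gradient hdiff hlip hint x)]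
    simp_rw [real_inner_comm]
    rfl
  rw [h1, ← Real.norm_eq_abs]
  refine (norm_integral_le_of_norm_le_const (C := ℓ / 2 * ‖y - x‖ ^ 2)
    (Filter.Eventually.of_forall fun ω => ?_)).trans (by simp)
  exact abs_sub_sub_inner_le_of_lipschitz_gradient (hdiff (z ω)) (hlip (z ω)) x y

theorem lipschitz_gradient_averagedObjective
    (hdiff : ∀ s : Z, Differentiable ℝ (fun x => f x s))
    (hlip : ∀ (s : Z) (x₁ x₂ : EuclideanSpace ℝ (Fin n)),
      ‖gradient (fun x => f x s) x₁ - gradient (fun x => f x s) x₂‖ ≤ ℓ * ‖x₁ - x₂‖)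
    (hint : ∀ x, Integrable (fun ω => f x (z ω)) P) (x y : EuclideanSpace ℝ (Fin n)) :
    ‖gradient (averagedObjective P z f) x - gradient (averagedObjective P z f) y‖
      ≤ ℓ * ‖x - y‖ := by
  rw [(hasGradientAt_averagedObjective hdiff hlip hint x).gradient,
    (hasGradientAt_averagedObjective hdiff hlip hint y).gradient,
    ← integral_sub (integrable_gradient hdiff hlip hint x) (integrable_gradient hdiff hlip hint y)]
  exact (norm_integral_le_of_norm_le_const (C := ℓ * ‖x - y‖)
    (Filter.Eventually.of_forall fun ω => hlip (z ω) x y)).trans (by simp)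

end AveragedObjective

/-! ### The Gibbs variational inequality. -/

section GibbsVariational

/-- Under the tilted measure `exp (ψ - f)` integrates to the quotient of the two partition
functions; Jensen's inequality for `exp` then gives the bound. -/
theorem integral_sub_tilted_le_log_sub_log {α : Type*} [MeasurableSpace α] {m : Measure α}
    [NeZero m] {f ψ : α → ℝ} (hf : Integrable (fun x => Real.exp (f x)) m)
    (hψ : Integrable (fun x => Real.exp (ψ x)) m)
    (hI : Integrable (fun x => ψ x - f x) (m.tilted f)) :
    ∫ x, (ψ x - f x) ∂(m.tilted f) ≤
      Real.log (∫ x, Real.exp (ψ x) ∂m) - Real.log (∫ x, Real.exp (f x) ∂m) := by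
  have := isProbabilityMeasure_tilted hf
  have hexp : Integrable (Real.exp ∘ fun x => ψ x - f x) (m.tilted f) := by
    rw [integrable_tilted_iff hf]
    refine hψ.congr (Filter.Eventually.of_forall fun x => ?_)
    simp [← Real.exp_add]
  have h := convexOn_exp.map_integral_le Real.continuous_exp.continuousOn isClosed_univ
    (Filter.Eventually.of_forall fun x => Set.mem_univ _) hI hexp
  rw [integral_exp_tilted] at h
  simp only [Pi.add_apply, add_sub_cancel] at h
  rw [← Real.log_div (integral_exp_pos hψ).ne' (integral_exp_pos hf).ne']
  exact (Real.le_log_iff_exp_le (div_pos (integral_exp_pos hψ) (integral_exp_pos hf))).2 h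

end GibbsVariational

/-! ### Gaussian integrals and domination. -/

section Gaussian

variable {n : ℕ}

theorem integral_exp_neg_mul_norm_sq {a : ℝ} (ha : 0 < a) :
    ∫ x : EuclideanSpace ℝ (Fin n), Real.exp (-a * ‖x‖ ^ 2) = (Real.pi / a) ^ ((n : ℝ) / 2) := by
  simpa using GaussianFourier.integral_rexp_neg_mul_sq_norm (V := EuclideanSpace ℝ (Fin n)) ha

theorem integrable_exp_neg_mul_norm_sq {a : ℝ} (ha : 0 < a) :
    Integrable fun x : EuclideanSpace ℝ (Fin n) => Real.exp (-a * ‖x‖ ^ 2) := by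
  -- A non-integrable function would have integral `0`, whereas the closed form is positive.
  refine not_imp_comm.1 integral_undef ?_
  rw [integral_exp_neg_mul_norm_sq ha]
  have := Real.pi_pos
  positivity

theorem one_add_sq_mul_exp_le {a : ℝ} (ha : 0 < a) (u : ℝ) :
    (1 + u ^ 2) * Real.exp (-a * u ^ 2) ≤ (1 + 2 / a) * Real.exp (-(a / 2) * u ^ 2) := by
  have h1 : Real.exp (-a * u ^ 2) =
      Real.exp (-(a / 2) * u ^ 2) * Real.exp (-(a / 2) * u ^ 2) := by
    rw [← Real.exp_add]
    ring_nf
  have h2 : (1 + u ^ 2) * Real.exp (-(a / 2) * u ^ 2) ≤ 1 + 2 / a := by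
    rw [neg_mul, Real.exp_neg, ← div_eq_mul_inv, div_le_iff₀ (Real.exp_pos _)]
    have h3 := Real.add_one_le_exp (a / 2 * u ^ 2)
    have h4 : 0 ≤ a / 2 * u ^ 2 := by positivity
    have h5 : 2 / a * (a / 2 * u ^ 2) = u ^ 2 := by field_simp
    have h6 : 0 < 2 / a := by positivity
    nlinarith
  rw [h1, ← mul_assoc]
  exact mul_le_mul_of_nonneg_right h2 (Real.exp_pos _).le

theorem integrableOn_exp_mul_of_le_gaussian {K : Set (EuclideanSpace ℝ (Fin n))}
    (hK : MeasurableSet K) {F H : EuclideanSpace ℝ (Fin n) → ℝ} (hF : Continuous F)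
    (hH : Continuous H) {a A C : ℝ} (ha : 0 < a)
    (hFA : ∀ x ∈ K, Real.exp (F x) ≤ A * Real.exp (-a * ‖x‖ ^ 2))
    (hHC : ∀ x, |H x| ≤ C * (1 + ‖x‖ ^ 2)) :
    IntegrableOn (fun x => Real.exp (F x) * H x) K := by
  refine Integrable.mono' (g := fun x => A * C * (1 + 2 / a) * Real.exp (-(a / 2) * ‖x‖ ^ 2))
    (((integrable_exp_neg_mul_norm_sq (by positivity)).const_mul _).integrableOn)
    ((Real.continuous_exp.comp hF).mul hH).aestronglyMeasurable ?_
  filter_upwards [ae_restrict_mem hK] with x hx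
  have hA : 0 ≤ A := by
    by_contra hneg
    nlinarith [hFA x hx, Real.exp_pos (F x), Real.exp_pos (-a * ‖x‖ ^ 2)]
  have hC : 0 ≤ C := by
    by_contra hneg
    nlinarith [hHC x, abs_nonneg (H x), sq_nonneg ‖x‖]
  rw [norm_mul, Real.norm_eq_abs, Real.abs_exp, Real.norm_eq_abs]
  calc Real.exp (F x) * |H x|
      ≤ A * Real.exp (-a * ‖x‖ ^ 2) * (C * (1 + ‖x‖ ^ 2)) :=
        mul_le_mul (hFA x hx) (hHC x) (abs_nonneg _) (by positivity)
    _ = A * C * ((1 + ‖x‖ ^ 2) * Real.exp (-a * ‖x‖ ^ 2)) := by ring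
    _ ≤ A * C * ((1 + 2 / a) * Real.exp (-(a / 2) * ‖x‖ ^ 2)) :=
        mul_le_mul_of_nonneg_left (one_add_sq_mul_exp_le ha _) (by positivity)
    _ = _ := by ring

end Gaussian

/-! ### Growth of the objective and existence of a minimiser. -/

section Growth

variable {n : ℕ} {K : Set (EuclideanSpace ℝ (Fin n))} {ℓ μ R β : ℝ}
  {g : EuclideanSpace ℝ (Fin n) → ℝ}

/-- Closer than `R` only the Lipschitz bound is available, and the deficit is absorbed by the
subtracted term. The minimum serves two purposes: `‖x - y‖` gives a loss that can be divided by `t`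
along a ray, `R` gives a bounded loss. -/
theorem StronglyConvexOutsideBall.sub_le_inner (hconv : StronglyConvexOutsideBall K μ R g)
    (hℓ : 0 < ℓ) (hμ : 0 < μ) (hR : 0 < R)
    (hl : ∀ x y, ‖gradient g x - gradient g y‖ ≤ ℓ * ‖x - y‖)
    {x y : EuclideanSpace ℝ (Fin n)} (hx : x ∈ K) (hy : y ∈ K) :
    μ * ‖x - y‖ ^ 2 - (ℓ + μ) * R * min R ‖x - y‖
      ≤ inner ℝ (x - y) (gradient g x - gradient g y) := by
  rcases le_or_gt R ‖x - y‖ with h | h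
  · have := hconv x hx y hy h
    rw [min_eq_left h]
    have : 0 ≤ (ℓ + μ) * R * R := by positivity
    linarith
  · rw [min_eq_right h.le]
    have h1 := (abs_le.1 (abs_real_inner_le_norm (x - y) (gradient g x - gradient g y))).1
    have h2 := mul_le_mul_of_nonneg_left (hl x y) (norm_nonneg (x - y))
    have h3 : (ℓ + μ) * ‖x - y‖ * ‖x - y‖ ≤ (ℓ + μ) * R * ‖x - y‖ := by gcongr
    nlinarith

theorem StronglyConvexOutsideBall.quadratic_growth (hconv : StronglyConvexOutsideBall K μ R g)
    (hℓ : 0 < ℓ) (hμ : 0 < μ) (hR : 0 < R) (hd : Differentiable ℝ g)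
    (hl : ∀ x y, ‖gradient g x - gradient g y‖ ≤ ℓ * ‖x - y‖)
    (hK : Convex ℝ K) (h0 : 0 ∈ K) {x : EuclideanSpace ℝ (Fin n)} (hx : x ∈ K) :
    g 0 + μ / 2 * ‖x‖ ^ 2 - ((ℓ + μ) * R + ‖gradient g 0‖) * ‖x‖ ≤ g x := by
  set C := (ℓ + μ) * R + ‖gradient g 0‖ with hC
  let φ : ℝ → ℝ := fun t => g (0 + t • x) + t * (C * ‖x‖) - μ / 2 * ‖x‖ ^ 2 * t ^ 2
  have hφ : ∀ t, HasDerivAt φ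
      (inner ℝ (gradient g (0 + t • x)) x + C * ‖x‖ - μ * ‖x‖ ^ 2 * t) t := by
    intro t
    have h := ((hasDerivAt_comp_line hd 0 x t).add ((hasDerivAt_id t).mul_const (C * ‖x‖))).sub
      ((hasDerivAt_pow 2 t).const_mul (μ / 2 * ‖x‖ ^ 2))
    convert! h using 1
    simp
    ring
  have hmono : MonotoneOn φ (Set.Icc 0 1) := by
    refine monotoneOn_of_deriv_nonneg (convex_Icc 0 1)
      (fun t _ => (hφ t).continuousAt.continuousWithinAt)
      (fun t _ => (hφ t).differentiableAt.differentiableWithinAt) fun t ht => ?_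
    rw [interior_Icc] at ht
    rw [(hφ t).deriv, zero_add]
    have hmem : t • x ∈ K := hK.smul_mem_of_zero_mem h0 hx ⟨ht.1.le, ht.2.le⟩
    have h1 := hconv.sub_le_inner hℓ hμ hR hl hmem h0
    rw [sub_zero, norm_smul, Real.norm_of_nonneg ht.1.le, real_inner_smul_left, inner_sub_right,
      real_inner_comm] at h1
    have h2 := (abs_le.1 (abs_real_inner_le_norm x (gradient g 0))).1
    have h3 : (ℓ + μ) * R * min R (t * ‖x‖) ≤ (ℓ + μ) * R * (t * ‖x‖) :=
      mul_le_mul_of_nonneg_left (min_le_right _ _) (by positivity)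
    have h4 : t * (μ * ‖x‖ ^ 2 * t - (ℓ + μ) * R * ‖x‖) ≤
        t * (inner ℝ (gradient g (t • x)) x - inner ℝ x (gradient g 0)) := by linarith
    have h5 := le_of_mul_le_mul_left h4 ht.1
    rw [hC]
    linarith
  have := hmono (Set.left_mem_Icc.2 zero_le_one) (Set.right_mem_Icc.2 zero_le_one) zero_le_one
  simp only [φ, zero_mul, zero_smul, add_zero, zero_add, one_mul, one_smul, one_pow,
    mul_one] at this
  linarith

theorem StronglyConvexOutsideBall.exp_le_gaussian (hconv : StronglyConvexOutsideBall K μ R g)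
    (hℓ : 0 < ℓ) (hμ : 0 < μ) (hR : 0 < R) (hβ : 0 < β) (hd : Differentiable ℝ g)
    (hl : ∀ x y, ‖gradient g x - gradient g y‖ ≤ ℓ * ‖x - y‖)
    (hK : Convex ℝ K) (h0 : 0 ∈ K) :
    ∃ A, ∀ x ∈ K, Real.exp (-β * g x) ≤ A * Real.exp (-(β * μ / 4) * ‖x‖ ^ 2) := by
  set C := (ℓ + μ) * R + ‖gradient g 0‖ with hC
  refine ⟨Real.exp (β * (C ^ 2 / μ - g 0)), fun x hx => ?_⟩
  rw [← Real.exp_add, Real.exp_le_exp]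
  have h1 := hconv.quadratic_growth hℓ hμ hR hd hl hK h0 hx
  -- Young's inequality: half of the quadratic growth pays for the linear term.
  have h2 : C * ‖x‖ ≤ μ / 4 * ‖x‖ ^ 2 + C ^ 2 / μ := by
    have h3 : C ^ 2 / μ * μ = C ^ 2 := div_mul_cancel₀ _ hμ.ne'
    have h4 : 0 ≤ (μ / 2 * ‖x‖ - C) ^ 2 := sq_nonneg _
    nlinarith
  have h3 : g 0 - C ^ 2 / μ + μ / 4 * ‖x‖ ^ 2 ≤ g x := by linarith
  nlinarith [mul_le_mul_of_nonneg_left h3 hβ.le]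

theorem abs_le_quadratic_of_lipschitz_gradient (hℓ : 0 < ℓ) (hd : Differentiable ℝ g)
    (hl : ∀ x y, ‖gradient g x - gradient g y‖ ≤ ℓ * ‖x - y‖) (x : EuclideanSpace ℝ (Fin n)) :
    |g x| ≤ (|g 0| + ‖gradient g 0‖ + ℓ / 2) * (1 + ‖x‖ ^ 2) := by
  have h1 := abs_sub_sub_inner_le_of_lipschitz_gradient hd hl 0 x
  rw [sub_zero] at h1
  have h2 := abs_real_inner_le_norm (gradient g 0) x
  have h3 : |g x| ≤ |g 0| + ‖gradient g 0‖ * ‖x‖ + ℓ / 2 * ‖x‖ ^ 2 := by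
    rw [abs_le] at *
    have := neg_abs_le (g 0)
    have := le_abs_self (g 0)
    constructor <;> linarith
  have h4 : ‖x‖ ≤ 1 + ‖x‖ ^ 2 := by nlinarith [sq_nonneg (‖x‖ - 1)]
  have h5 := mul_le_mul_of_nonneg_left h4 (norm_nonneg (gradient g 0))
  have h6 : 0 ≤ |g 0| * ‖x‖ ^ 2 := by positivity
  linarith

theorem StronglyConvexOutsideBall.exists_isMinOn (hconv : StronglyConvexOutsideBall K μ R g)
    (hℓ : 0 < ℓ) (hμ : 0 < μ) (hR : 0 < R) (hd : Differentiable ℝ g)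
    (hl : ∀ x y, ‖gradient g x - gradient g y‖ ≤ ℓ * ‖x - y‖)
    (hK : Convex ℝ K) (hKc : IsClosed K) (h0 : 0 ∈ K) : ∃ x ∈ K, IsMinOn g K x := by
  refine hd.continuous.continuousOn.exists_isMinOn' hKc h0 ?_
  set C := (ℓ + μ) * R + ‖gradient g 0‖ with hC
  have hC0 : 0 ≤ C := by positivity
  rw [Filter.eventually_inf_principal]
  filter_upwards [(tendsto_norm_cocompact_atTop (E := EuclideanSpace ℝ (Fin n))).eventually_ge_atTop
    (2 * C / μ)] with x hx hxK
  have h1 := hconv.quadratic_growth hℓ hμ hR hd hl hK h0 hxK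
  rw [div_le_iff₀ hμ] at hx
  nlinarith [norm_nonneg x]

theorem IsMinOn.inner_sub_gradient_nonneg {x y : EuclideanSpace ℝ (Fin n)} (hmin : IsMinOn g K x)
    (hd : Differentiable ℝ g) (hK : Convex ℝ K) (hx : x ∈ K) (hy : y ∈ K) :
    0 ≤ inner ℝ (y - x) (gradient g x) := by
  have h := hmin.localize.hasFDerivWithinAt_nonneg (hd x).hasFDerivAt.hasFDerivWithinAt
    (sub_mem_posTangentConeAt_of_segment_subset (hK.segment_subset hx hy))
  rwa [← inner_gradient_left, real_inner_comm] at h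

end Growth

/-! ### Uniform inscribed balls in a polyhedron. -/

section Polyhedron

variable {n : ℕ} {K : Set (EuclideanSpace ℝ (Fin n))}

theorem IsPolyhedron.convex (hK : IsPolyhedron K) : Convex ℝ K := by
  obtain ⟨p, a, b, -, rfl⟩ := hK
  rw [Set.ofPred_forall]
  exact convex_iInter fun i => convex_halfSpace_le (innerSL ℝ (a i)).isLinear (b i)

theorem IsPolyhedron.isClosed (hK : IsPolyhedron K) : IsClosed K := by
  obtain ⟨p, a, b, -, rfl⟩ := hK
  rw [Set.ofPred_forall]
  exact isClosed_iInter fun i => isClosed_le (by fun_prop) continuous_const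

/-- Shrinking `x` towards `0` would leave the boundary, but the step `τ • x` is not uniformly short
when `K` is unbounded. Instead `x` is shifted by `-τ • v`, where `v` is a representative with the
same nearly active constraints as `x`. Finitely many representatives suffice, so one `τ` serves all
`x`. -/
theorem IsPolyhedron.exists_uniform_closedBall_subset (hK : IsPolyhedron K)
    (hK0 : 0 ∈ interior K) {ε : ℝ} (hε : 0 < ε) :
    ∃ r, 0 < r ∧ ∀ x ∈ K, ∃ y, Metric.closedBall y r ⊆ K ∩ Metric.closedBall x ε := by
  classical
  obtain ⟨m, hm, hmK⟩ := Metric.nhds_basis_closedBall.mem_iff.1 (mem_interior_iff_mem_nhds.1 hK0)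
  obtain ⟨p, a, b, ha, rfl⟩ := hK
  set K := {x | ∀ i, inner ℝ (a i) x ≤ b i} with hKdef
  have hb : ∀ i, m ≤ b i := fun i => by
    have h : m • a i ∈ K := hmK (by simp [norm_smul, ha, abs_of_pos hm])
    have h2 := h i
    rwa [real_inner_smul_right, real_inner_self_eq_norm_sq, ha, one_pow, mul_one] at h2
  let I : EuclideanSpace ℝ (Fin n) → Finset (Fin p) := fun x =>
    Finset.univ.filter fun i => b i - inner ℝ (a i) x ≤ m / 2
  have hrep : ∀ J : Finset (Fin p), ∃ w, (∃ x ∈ K, I x = J) → w ∈ K ∧ I w = J := fun J => by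
    by_cases h : ∃ x ∈ K, I x = J
    · exact ⟨h.choose, fun _ => h.choose_spec⟩
    · exact ⟨0, fun h' => absurd h' h⟩
  choose w hw using hrep
  set V : ℝ := 1 + ∑ J, ‖w J‖ with hV
  have hV1 : 1 ≤ V := le_add_of_nonneg_right (Finset.sum_nonneg fun _ _ => norm_nonneg _)
  have hwV : ∀ J, ‖w J‖ ≤ V := fun J => by
    have := Finset.single_le_sum (f := fun J => ‖w J‖) (fun J _ => norm_nonneg _)
      (Finset.mem_univ J)
    linarith
  set q := min ε m / 4 with hq
  have hq0 : 0 < q := by positivity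
  have hqε : q ≤ ε / 4 := by
    have := min_le_left ε m
    linarith
  have hqm : q ≤ m / 4 := by
    have := min_le_right ε m
    linarith
  have hV0 : 0 < V := by linarith
  set τ := q / V with hτ
  have hτ0 : 0 < τ := by positivity
  have hτw : ∀ J, τ * ‖w J‖ ≤ q := fun J => by
    calc τ * ‖w J‖ ≤ τ * V := mul_le_mul_of_nonneg_left (hwV J) hτ0.le
      _ = q := div_mul_cancel₀ _ hV0.ne'
  refine ⟨min (τ * (m / 2)) q, by positivity, fun x hx => ?_⟩
  obtain ⟨-, hwI⟩ := hw (I x) ⟨x, hx, rfl⟩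
  set v := w (I x) with hv
  refine ⟨x - τ • v, fun u hu => ?_⟩
  rw [Metric.mem_closedBall, dist_eq_norm] at hu
  -- A nearly active constraint has `inner ℝ (a i) v ≥ b i - m / 2 ≥ m / 2`, so the shift gains `τ *
  -- (m / 2)`. Any other has slack above `m / 2` and loses at most `q ≤ m / 4`.
  have hslack : ∀ i, inner ℝ (a i) (x - τ • v) + min (τ * (m / 2)) q ≤ b i := fun i => by
    rw [inner_sub_right, real_inner_smul_right]
    by_cases hi : i ∈ I x
    · have h1 : i ∈ I v := hwI.symm ▸ hi
      simp only [I, Finset.mem_filter, Finset.mem_univ, true_and] at h1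
      have h2 : τ * (m / 2) ≤ τ * inner ℝ (a i) v :=
        mul_le_mul_of_nonneg_left (by linarith [hb i]) hτ0.le
      have h3 := hx i
      have h4 := min_le_left (τ * (m / 2)) q
      linarith
    · simp only [I, Finset.mem_filter, Finset.mem_univ, true_and, not_le] at hi
      have h1 := (abs_le.1 (abs_real_inner_le_norm (a i) v)).1
      rw [ha, one_mul] at h1
      have h2 := mul_le_mul_of_nonneg_left h1 hτ0.le
      have h3 := hτw (I x)
      have h4 := min_le_right (τ * (m / 2)) q
      linarith
  constructor
  · intro i
    have h1 := real_inner_le_norm (a i) (u - (x - τ • v))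
    rw [ha, one_mul, inner_sub_right] at h1
    linarith [hslack i]
  · rw [Metric.mem_closedBall, dist_eq_norm]
    have h1 : u - x = (u - (x - τ • v)) - τ • v := by abel
    rw [h1]
    refine (norm_sub_le _ _).trans ?_
    rw [norm_smul, Real.norm_of_nonneg hτ0.le]
    have h3 := hτw (I x)
    have h4 := min_le_right (τ * (m / 2)) q
    linarith

theorem bddAbove_chebyshevRadius (hn : 1 ≤ n) (ε : ℝ) (x : EuclideanSpace ℝ (Fin n)) :
    BddAbove {r : ℝ | 0 ≤ r ∧ ∃ y, Metric.closedBall y r ⊆ K ∩ Metric.closedBall x ε} := by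
  refine ⟨ε, fun r ⟨hr, y, hy⟩ => ?_⟩
  -- A unit direction requires `n ≥ 1`; in dimension `0` every ball is a point and the admissible
  -- radii can be unbounded.
  let e : EuclideanSpace ℝ (Fin n) := EuclideanSpace.single ⟨0, hn⟩ 1
  have he : ‖e‖ = 1 := by simp [e]
  have h1 : y + r • e ∈ Metric.closedBall y r := by simp [norm_smul, he, abs_of_nonneg hr]
  have h2 : y - r • e ∈ Metric.closedBall y r := by simp [norm_smul, he, abs_of_nonneg hr]
  have h3 := (hy h1).2
  have h4 := (hy h2).2
  rw [Metric.mem_closedBall] at h3 h4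
  have h5 := dist_triangle_right (y + r • e) (y - r • e) x
  have h6 : dist (y + r • e) (y - r • e) = 2 * r := by
    rw [dist_eq_norm, add_sub_sub_cancel, ← two_smul ℝ, norm_smul, norm_smul, he, mul_one]
    simp [abs_of_nonneg hr]
  linarith

theorem IsPolyhedron.exists_isUniformChebyshevBound (hn : 1 ≤ n) (hK : IsPolyhedron K)
    (hK0 : 0 ∈ interior K) {ε : ℝ} (hε : 0 < ε) : ∃ r, IsUniformChebyshevBound K ε r := by
  obtain ⟨r, hr, h⟩ := hK.exists_uniform_closedBall_subset hK0 hε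
  exact ⟨r, hr, fun x hx => le_csSup (bddAbove_chebyshevRadius hn ε x) ⟨hr.le, h x hx⟩⟩

theorem exists_closedBall_subset_of_lt_chebyshevRadius {ε r : ℝ} {x : EuclideanSpace ℝ (Fin n)}
    (hr : 0 < r) (h : r < chebyshevRadius K ε x) :
    ∃ r' y, r < r' ∧ Metric.closedBall y r' ⊆ K ∩ Metric.closedBall x ε := by
  have hne : {r : ℝ | 0 ≤ r ∧
      ∃ y, Metric.closedBall y r ⊆ K ∩ Metric.closedBall x ε}.Nonempty := by
    by_contra hne
    rw [Set.not_nonempty_iff_eq_empty] at hne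
    rw [chebyshevRadius, hne, Real.sSup_empty] at h
    exact hr.not_gt h
  obtain ⟨r', ⟨-, y, hy⟩, hr'⟩ := exists_lt_of_lt_csSup hne h
  exact ⟨r', y, hr', hy⟩

end Polyhedron

/-! ### The localization radius. -/

section LocalRadius

variable {n : ℕ} {ℓ μ R β : ℝ} {g : EuclideanSpace ℝ (Fin n) → ℝ}

theorem localRadius_pos (hℓ : 0 < ℓ) (hR : 0 < R) (hβ : 0 < β) : 0 < localRadius ℓ μ R β g := by
  have hd : 0 ≤ gradBound ℓ μ R g := by
    have : R ≤ max R (‖gradient g 0‖ / μ) := le_max_left _ _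
    unfold gradBound
    have : 0 ≤ ℓ * max R (‖gradient g 0‖ / μ) := by positivity
    positivity
  have h2 : 0 < Real.log 2 := Real.log_pos one_lt_two
  have h : gradBound ℓ μ R g <
      Real.sqrt (gradBound ℓ μ R g ^ 2 + 2 * ℓ * (1 / β) * Real.log 2) := by
    apply Real.lt_sqrt_of_sq_lt
    have : 0 < 2 * ℓ * (1 / β) * Real.log 2 := by positivity
    linarith
  unfold localRadius
  have := mul_lt_mul_of_pos_left h (one_div_pos.2 hℓ)
  linarith

/-- `localRadius` is a root of this quadratic equation. The left side is the Taylor bound for the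
rise of `g` near `w`, so the Gibbs density drops there by a factor of at most `2`. -/
theorem gradBound_mul_localRadius_add (hℓ : 0 < ℓ) (hβ : 0 < β) :
    gradBound ℓ μ R g * localRadius ℓ μ R β g + ℓ / 2 * localRadius ℓ μ R β g ^ 2
      = Real.log 2 / β := by
  have h2 : 0 < Real.log 2 := Real.log_pos one_lt_two
  have hs : 0 ≤ gradBound ℓ μ R g ^ 2 + 2 * ℓ * (1 / β) * Real.log 2 := by positivity
  have h := Real.sq_sqrt hs
  unfold localRadius
  set s := Real.sqrt (gradBound ℓ μ R g ^ 2 + 2 * ℓ * (1 / β) * Real.log 2)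
  set d := gradBound ℓ μ R g
  have e : d * (-(1 / ℓ) * d + 1 / ℓ * s) + ℓ / 2 * (-(1 / ℓ) * d + 1 / ℓ * s) ^ 2
      = (s ^ 2 - d ^ 2) / (2 * ℓ) := by
    field_simp
    ring
  rw [e, h]
  field_simp
  ring

end LocalRadius

/-! ### A bound on the Gamma factor in the ball volume. -/

section GammaBound

theorem log_Gamma_half_add_one_le {n : ℕ} (hn : 1 ≤ n) :
    Real.log (Real.Gamma (n / 2 + 1)) ≤ n * Real.log n := by
  have hn' : (1 : ℝ) ≤ n := by exact_mod_cast hn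
  rw [← Real.log_pow]
  refine Real.log_le_log (Real.Gamma_pos_of_pos (by positivity)) ?_
  -- Monotonicity of `Γ` is used on `[2, ∞)`, which misses `n / 2 + 1 = 3 / 2` when `n = 1`.
  rcases hn.eq_or_lt with rfl | h2
  · have := Real.Gamma_three_div_two_lt_one
    norm_num at this ⊢
    exact this.le
  · have h2' : (2 : ℝ) ≤ n := by exact_mod_cast h2
    calc Real.Gamma (n / 2 + 1) ≤ Real.Gamma (n + 1) :=
          Real.Gamma_strictMonoOn_Ici.monotoneOn (by simp; linarith) (by simp; linarith)
            (by linarith)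
      _ = (n.factorial : ℝ) := Real.Gamma_nat_eq_factorial n
      _ ≤ (n : ℝ) ^ n := by exact_mod_cast Nat.factorial_le_pow n

end GammaBound

/-! ### Homotheties and the second moment of the Gibbs measure. -/

section GibbsEstimates

variable {n : ℕ} {K : Set (EuclideanSpace ℝ (Fin n))} {ℓ μ R β : ℝ}
  {g : EuclideanSpace ℝ (Fin n) → ℝ}

theorem setIntegral_comp_homothety_le (hK : Convex ℝ K) (hKm : MeasurableSet K)
    {F : EuclideanSpace ℝ (Fin n) → ℝ} (hF : IntegrableOn F K) (hF0 : ∀ x, 0 ≤ F x)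
    {w : EuclideanSpace ℝ (Fin n)} (hw : w ∈ K) {lam : ℝ} (h0 : 0 < lam) (h1 : lam ≤ 1) :
    IntegrableOn (fun y => F (lam • y + (1 - lam) • w)) K ∧
    ∫ y in K, F (lam • y + (1 - lam) • w) ≤ (lam ^ n)⁻¹ * ∫ y in K, F y := by
  have hG : Integrable (K.indicator F) := (integrable_indicator_iff hKm).2 hF
  have hG' : Integrable fun y => K.indicator F (lam • y + (1 - lam) • w) :=
    (hG.comp_add_right ((1 - lam) • w)).comp_smul h0.ne'
  have hEq : ∀ y ∈ K, K.indicator F (lam • y + (1 - lam) • w) = F (lam • y + (1 - lam) • w) :=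
    fun y hy => Set.indicator_of_mem (hK hy hw h0.le (by linarith) (by ring)) F
  refine ⟨hG'.integrableOn.congr_fun hEq hKm, ?_⟩
  rw [← setIntegral_congr_fun hKm hEq]
  refine (setIntegral_le_integral hG'
    (Filter.Eventually.of_forall fun y => Set.indicator_nonneg (fun x _ => hF0 x) _)).trans ?_
  rw [Measure.integral_comp_smul_of_nonneg volume
      (fun y => K.indicator F (y + (1 - lam) • w)) lam (hR := h0.le),
    integral_add_right_eq_self (K.indicator F), integral_indicator hKm]
  simp

theorem exists_abs_comp_homothety_le {H : EuclideanSpace ℝ (Fin n) → ℝ} {C : ℝ}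
    (hH : ∀ x, |H x| ≤ C * (1 + ‖x‖ ^ 2)) (w : EuclideanSpace ℝ (Fin n)) (s c : ℝ) :
    ∃ C', ∀ x, |H (s • x + c • w)| ≤ C' * (1 + ‖x‖ ^ 2) := by
  have hC : 0 ≤ C := by simpa using (abs_nonneg _).trans (hH 0)
  refine ⟨C * (1 + 2 * ‖s‖ ^ 2 + 2 * ‖c • w‖ ^ 2), fun x => (hH _).trans ?_⟩
  rw [mul_assoc]
  refine mul_le_mul_of_nonneg_left ?_ hC
  have h1 : ‖s • x + c • w‖ ^ 2 ≤ (‖s‖ * ‖x‖ + ‖c • w‖) ^ 2 := by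
    rw [← norm_smul]
    gcongr
    exact norm_add_le _ _
  nlinarith [sq_nonneg (‖s‖ * ‖x‖ - ‖c • w‖), sq_nonneg ‖x‖, sq_nonneg ‖s‖,
    mul_nonneg (sq_nonneg ‖c • w‖) (sq_nonneg ‖x‖)]

theorem ae_mem_gibbsMeasure (hKm : MeasurableSet K) : ∀ᵐ x ∂(gibbsMeasure K β g), x ∈ K :=
  (tilted_absolutelyContinuous _ _).ae_le (ae_restrict_mem hKm)

theorem StronglyConvexOutsideBall.integrableOn_exp_mul
    (hconv : StronglyConvexOutsideBall K μ R g)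
    (hℓ : 0 < ℓ) (hμ : 0 < μ) (hR : 0 < R) (hβ : 0 < β) (hd : Differentiable ℝ g)
    (hl : ∀ x y, ‖gradient g x - gradient g y‖ ≤ ℓ * ‖x - y‖)
    (hK : Convex ℝ K) (hKm : MeasurableSet K) (h0 : 0 ∈ K)
    {H : EuclideanSpace ℝ (Fin n) → ℝ} (hH : Continuous H) {C : ℝ}
    (hHC : ∀ x, |H x| ≤ C * (1 + ‖x‖ ^ 2)) :
    IntegrableOn (fun x => Real.exp (-β * g x) * H x) K := by
  obtain ⟨A, hA⟩ := hconv.exp_le_gaussian hℓ hμ hR hβ hd hl hK h0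
  have := hd.continuous
  exact integrableOn_exp_mul_of_le_gaussian hKm (by fun_prop) hH (by positivity) hA hHC

theorem StronglyConvexOutsideBall.integrableOn_exp (hconv : StronglyConvexOutsideBall K μ R g)
    (hℓ : 0 < ℓ) (hμ : 0 < μ) (hR : 0 < R) (hβ : 0 < β) (hd : Differentiable ℝ g)
    (hl : ∀ x y, ‖gradient g x - gradient g y‖ ≤ ℓ * ‖x - y‖)
    (hK : Convex ℝ K) (hKm : MeasurableSet K) (h0 : 0 ∈ K) :
    IntegrableOn (fun x => Real.exp (-β * g x)) K := by
  simpa using hconv.integrableOn_exp_mul hℓ hμ hR hβ hd hl hK hKm h0 (H := fun _ => 1)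
    continuous_const (C := 1) (fun x => by simp)

theorem StronglyConvexOutsideBall.integrable_gibbsMeasure
    (hconv : StronglyConvexOutsideBall K μ R g)
    (hℓ : 0 < ℓ) (hμ : 0 < μ) (hR : 0 < R) (hβ : 0 < β) (hd : Differentiable ℝ g)
    (hl : ∀ x y, ‖gradient g x - gradient g y‖ ≤ ℓ * ‖x - y‖)
    (hK : Convex ℝ K) (hKm : MeasurableSet K) (h0 : 0 ∈ K)
    {H : EuclideanSpace ℝ (Fin n) → ℝ} (hH : Continuous H) {C : ℝ}
    (hHC : ∀ x, |H x| ≤ C * (1 + ‖x‖ ^ 2)) : Integrable H (gibbsMeasure K β g) :=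
  (integrable_tilted_iff (hconv.integrableOn_exp hℓ hμ hR hβ hd hl hK hKm h0) H).2
    (hconv.integrableOn_exp_mul hℓ hμ hR hβ hd hl hK hKm h0 hH hHC)

theorem norm_sub_sq_le_quadratic (w x : EuclideanSpace ℝ (Fin n)) :
    |‖x - w‖ ^ 2| ≤ (2 + 2 * ‖w‖ ^ 2) * (1 + ‖x‖ ^ 2) := by
  rw [abs_of_nonneg (sq_nonneg _)]
  have h : ‖x - w‖ ^ 2 ≤ (‖x‖ + ‖w‖) ^ 2 := by
    gcongr
    exact norm_sub_le _ _
  nlinarith [sq_nonneg (‖x‖ - ‖w‖), mul_nonneg (sq_nonneg ‖w‖) (sq_nonneg ‖x‖)]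

/-- The Taylor upper bound is taken at `y`. First-order optimality at `w` allows `gradient g w` to
be discarded from the monotonicity estimate. -/
theorem StronglyConvexOutsideBall.sub_homothety_ge (hconv : StronglyConvexOutsideBall K μ R g)
    (hℓ : 0 < ℓ) (hμ : 0 < μ) (hR : 0 < R) (hd : Differentiable ℝ g)
    (hl : ∀ x y, ‖gradient g x - gradient g y‖ ≤ ℓ * ‖x - y‖) (hK : Convex ℝ K)
    {w : EuclideanSpace ℝ (Fin n)} (hw : w ∈ K) (hmin : IsMinOn g K w) {lam : ℝ} (h1 : lam ≤ 1)
    {y : EuclideanSpace ℝ (Fin n)} (hy : y ∈ K) :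
    (1 - lam) * ((μ - ℓ / 2 * (1 - lam)) * ‖y - w‖ ^ 2 - (ℓ + μ) * R ^ 2)
      ≤ g y - g (lam • y + (1 - lam) • w) := by
  have h2 := le_add_inner_add_sq_of_lipschitz_gradient hd hl y (lam • y + (1 - lam) • w)
  have e : lam • y + (1 - lam) • w - y = -((1 - lam) • (y - w)) := by module
  rw [e, norm_neg, norm_smul, inner_neg_right, real_inner_smul_right,
    Real.norm_of_nonneg (by linarith), real_inner_comm] at h2
  have h3 := hconv.sub_le_inner hℓ hμ hR hl hy hw
  rw [inner_sub_right] at h3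
  have h4 := hmin.inner_sub_gradient_nonneg hd hK hw hy
  have h5 : (ℓ + μ) * R * min R ‖y - w‖ ≤ (ℓ + μ) * R * R :=
    mul_le_mul_of_nonneg_left (min_le_left _ _) (by positivity)
  have h6 : μ * ‖y - w‖ ^ 2 - (ℓ + μ) * R ^ 2 ≤ inner ℝ (y - w) (gradient g y) := by
    nlinarith
  have h7 := mul_le_mul_of_nonneg_left h6 (sub_nonneg.2 h1)
  nlinarith

theorem StronglyConvexOutsideBall.integral_sub_homothety_le
    (hconv : StronglyConvexOutsideBall K μ R g)
    (hℓ : 0 < ℓ) (hμ : 0 < μ) (hR : 0 < R) (hβ : 0 < β) (hd : Differentiable ℝ g)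
    (hl : ∀ x y, ‖gradient g x - gradient g y‖ ≤ ℓ * ‖x - y‖)
    (hK : Convex ℝ K) (hKm : MeasurableSet K) (h0 : 0 ∈ K) [NeZero (volume.restrict K)]
    {w : EuclideanSpace ℝ (Fin n)} (hw : w ∈ K) {lam : ℝ} (hlam : 0 < lam) (h1 : lam ≤ 1) :
    Integrable (fun y => g y - g (lam • y + (1 - lam) • w)) (gibbsMeasure K β g) ∧
    β * ∫ y, (g y - g (lam • y + (1 - lam) • w)) ∂(gibbsMeasure K β g)
      ≤ n * (lam⁻¹ - 1) := by
  have hgc := hd.continuous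
  have hexp := hconv.integrableOn_exp hℓ hμ hR hβ hd hl hK hKm h0
  have hgq := abs_le_quadratic_of_lipschitz_gradient hℓ hd hl
  obtain ⟨C, hC⟩ := exists_abs_comp_homothety_le hgq w lam (1 - lam)
  have hint : Integrable (fun y => g y - g (lam • y + (1 - lam) • w)) (gibbsMeasure K β g) :=
    (hconv.integrable_gibbsMeasure hℓ hμ hR hβ hd hl hK hKm h0 hgc hgq).sub
      (hconv.integrable_gibbsMeasure hℓ hμ hR hβ hd hl hK hKm h0 (by fun_prop) hC)
  refine ⟨hint, ?_⟩
  obtain ⟨hi, hle⟩ := setIntegral_comp_homothety_le hK hKm hexp (fun x => (Real.exp_pos _).le)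
    hw hlam h1
  have hEq : ∀ y, -β * g (lam • y + (1 - lam) • w) - -β * g y =
      β * (g y - g (lam • y + (1 - lam) • w)) := fun y => by ring
  have key := integral_sub_tilted_le_log_sub_log hexp hi
    (by simp_rw [hEq]; exact hint.const_mul β)
  simp_rw [hEq] at key
  rw [integral_const_mul] at key
  refine key.trans ?_
  have hZ : 0 < ∫ y in K, Real.exp (-β * g y) := integral_exp_pos hexp
  have hle2 := Real.log_le_log (integral_exp_pos hi) hle
  rw [Real.log_mul (by positivity) hZ.ne', Real.log_inv, Real.log_pow] at hle2
  have h2 := mul_le_mul_of_nonneg_left (Real.one_sub_inv_le_log_of_pos hlam)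
    (Nat.cast_nonneg (α := ℝ) n)
  linarith

/-- This is the estimate that integrating the divergence of `(y - w) exp (-β g)` would give;
differentiating the homothety bound at `λ = 1` replaces the boundary flux. -/
theorem StronglyConvexOutsideBall.integral_norm_sub_sq_le
    (hconv : StronglyConvexOutsideBall K μ R g)
    (hℓ : 0 < ℓ) (hμ : 0 < μ) (hR : 0 < R) (hβ : 0 < β) (hd : Differentiable ℝ g)
    (hl : ∀ x y, ‖gradient g x - gradient g y‖ ≤ ℓ * ‖x - y‖)
    (hK : Convex ℝ K) (hKm : MeasurableSet K) (h0 : 0 ∈ K) [NeZero (volume.restrict K)]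
    {w : EuclideanSpace ℝ (Fin n)} (hw : w ∈ K) (hmin : IsMinOn g K w) :
    μ * ∫ y, ‖y - w‖ ^ 2 ∂(gibbsMeasure K β g) ≤ (ℓ + μ) * R ^ 2 + n / β := by
  have hprob : IsProbabilityMeasure (gibbsMeasure K β g) :=
    isProbabilityMeasure_tilted (hconv.integrableOn_exp hℓ hμ hR hβ hd hl hK hKm h0)
  have hS := hconv.integrable_gibbsMeasure hℓ hμ hR hβ hd hl hK hKm h0
    (H := fun y => ‖y - w‖ ^ 2) (by fun_prop) (norm_sub_sq_le_quadratic w)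
  set S := ∫ y, ‖y - w‖ ^ 2 ∂(gibbsMeasure K β g) with hSdef
  have key : ∀ lam : ℝ, 0 < lam → lam < 1 →
      (μ - ℓ / 2 * (1 - lam)) * S - (ℓ + μ) * R ^ 2 ≤ n / β * lam⁻¹ := by
    intro lam hlam h1
    obtain ⟨hi, hle⟩ := hconv.integral_sub_homothety_le hℓ hμ hR hβ hd hl hK hKm h0 hw hlam h1.le
    have hmono := integral_mono_ae
      (((hS.const_mul (μ - ℓ / 2 * (1 - lam))).sub
        (integrable_const ((ℓ + μ) * R ^ 2))).const_mul (1 - lam)) hi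
      ((ae_mem_gibbsMeasure hKm).mono fun y hy =>
        hconv.sub_homothety_ge hℓ hμ hR hd hl hK hw hmin h1.le hy)
    simp only [Pi.sub_apply] at hmono
    rw [integral_const_mul, integral_sub (hS.const_mul _) (integrable_const _),
      integral_const_mul, integral_const, probReal_univ, one_smul, ← hSdef] at hmono
    have h2 := (mul_le_mul_of_nonneg_left hmono hβ.le).trans hle
    have h3 : (n : ℝ) * (lam⁻¹ - 1) = β * ((1 - lam) * (n / β * lam⁻¹)) := by
      field_simp
    rw [h3] at h2
    exact le_of_mul_le_mul_left (le_of_mul_le_mul_left h2 hβ) (sub_pos.2 h1)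
  have hlim1 : Filter.Tendsto (fun lam : ℝ => (μ - ℓ / 2 * (1 - lam)) * S - (ℓ + μ) * R ^ 2)
      (nhdsWithin 1 (Set.Iio 1)) (nhds ((μ - ℓ / 2 * (1 - 1)) * S - (ℓ + μ) * R ^ 2)) :=
    (Continuous.tendsto (by fun_prop) 1).mono_left nhdsWithin_le_nhds
  have hlim2 : Filter.Tendsto (fun lam : ℝ => n / β * lam⁻¹)
      (nhdsWithin 1 (Set.Iio 1)) (nhds (n / β * 1⁻¹)) :=
    ((tendsto_inv₀ one_ne_zero).const_mul _).mono_left nhdsWithin_le_nhds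
  have h := le_of_tendsto_of_tendsto hlim1 hlim2 (by
    filter_upwards [Ioo_mem_nhdsLT (zero_lt_one' ℝ)] with lam hl
    exact key lam hl.1 hl.2)
  norm_num at h
  linarith

/-! ### Lower bound on the partition function and the final estimate. -/

theorem StronglyConvexOutsideBall.norm_gradient_le_gradBound
    (hconv : StronglyConvexOutsideBall K μ R g)
    (hℓ : 0 < ℓ) (hμ : 0 < μ) (hd : Differentiable ℝ g)
    (hl : ∀ x y, ‖gradient g x - gradient g y‖ ≤ ℓ * ‖x - y‖) (hK : Convex ℝ K) (h0 : 0 ∈ K)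
    {w : EuclideanSpace ℝ (Fin n)} (hw : w ∈ K) (hmin : IsMinOn g K w) :
    ‖gradient g w‖ ≤ gradBound ℓ μ R g := by
  have hw' : ‖w‖ ≤ max R (‖gradient g 0‖ / μ) := by
    rcases le_or_gt R ‖w‖ with h | h
    · refine le_max_of_le_right ?_
      have h1 := hconv w hw 0 h0 (by simpa using h)
      have h2 := hmin.inner_sub_gradient_nonneg hd hK hw h0
      have h3 := (abs_le.1 (abs_real_inner_le_norm w (gradient g 0))).1
      rw [sub_zero, inner_sub_right] at h1
      rw [zero_sub, inner_neg_left] at h2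
      rw [le_div_iff₀ hμ]
      -- `R` may be nonpositive here, so `R ≤ ‖w‖` does not exclude `w = 0`.
      rcases (norm_nonneg w).eq_or_lt with hz | hz
      · rw [← hz, zero_mul]
        exact norm_nonneg _
      · refine le_of_mul_le_mul_left ?_ hz
        nlinarith
    · exact h.le.trans (le_max_left _ _)
  have h1 := hl w 0
  rw [sub_zero] at h1
  have h2 := norm_le_norm_sub_add (gradient g w) (gradient g 0)
  have h3 := mul_le_mul_of_nonneg_left hw' hℓ.le
  unfold gradBound
  linarith

theorem StronglyConvexOutsideBall.log_partition_ge (hn : 1 ≤ n)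
    (hconv : StronglyConvexOutsideBall K μ R g)
    (hℓ : 0 < ℓ) (hμ : 0 < μ) (hR : 0 < R) (hβ : 0 < β) (hd : Differentiable ℝ g)
    (hl : ∀ x y, ‖gradient g x - gradient g y‖ ≤ ℓ * ‖x - y‖)
    (hK : Convex ℝ K) (hKm : MeasurableSet K) (h0 : 0 ∈ K)
    {w : EuclideanSpace ℝ (Fin n)} (hw : w ∈ K) (hmin : IsMinOn g K w)
    {y : EuclideanSpace ℝ (Fin n)} {r : ℝ} (hr : 0 < r)
    (hball : Metric.closedBall y r ⊆ K ∩ Metric.closedBall w (localRadius ℓ μ R β g)) :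
    n * Real.log r + n / 2 * Real.log Real.pi - n * Real.log n - β * g w - Real.log 2
      ≤ Real.log (∫ x in K, Real.exp (-β * g x)) := by
  have : Nonempty (Fin n) := ⟨⟨0, hn⟩⟩
  have hexp := hconv.integrableOn_exp hℓ hμ hR hβ hd hl hK hKm h0
  have hd0 := hconv.norm_gradient_le_gradBound hℓ hμ hd hl hK h0 hw hmin
  have hd1 := (norm_nonneg _).trans hd0
  have hε := localRadius_pos (μ := μ) (g := g) hℓ hR hβ
  have hsub : Metric.closedBall y r ⊆ K := fun x hx => (hball hx).1
  have hg : ∀ x ∈ Metric.closedBall y r,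
      Real.exp (-(β * g w + Real.log 2)) ≤ Real.exp (-β * g x) := fun x hx => by
    have hx := (hball hx).2
    rw [mem_closedBall_iff_norm] at hx
    have h1 := le_add_inner_add_sq_of_lipschitz_gradient hd hl w x
    have h2 := real_inner_le_norm (gradient g w) (x - w)
    have h3 : ‖gradient g w‖ * ‖x - w‖ ≤ gradBound ℓ μ R g * localRadius ℓ μ R β g := by gcongr
    have h4 : ℓ / 2 * ‖x - w‖ ^ 2 ≤ ℓ / 2 * localRadius ℓ μ R β g ^ 2 := by gcongr
    have h5 : gradBound ℓ μ R g * localRadius ℓ μ R β g + ℓ / 2 * localRadius ℓ μ R β g ^ 2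
      = Real.log 2 / β := gradBound_mul_localRadius_add hℓ hβ
    have h6 : g x ≤ g w + Real.log 2 / β := by linarith
    have h7 := mul_le_mul_of_nonneg_left h6 hβ.le
    rw [mul_add, mul_div_cancel₀ _ hβ.ne'] at h7
    rw [Real.exp_le_exp]
    linarith
  have hΓ : 0 < Real.Gamma ((n : ℝ) / 2 + 1) := Real.Gamma_pos_of_pos (by positivity)
  have hvol : volume.real (Metric.closedBall y r) =
      r ^ n * (Real.sqrt Real.pi ^ n / Real.Gamma ((n : ℝ) / 2 + 1)) := by
    rw [measureReal_def, EuclideanSpace.volume_closedBall, Fintype.card_fin, ENNReal.toReal_mul,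
      ENNReal.toReal_pow, ENNReal.toReal_ofReal hr.le, ENNReal.toReal_ofReal (by positivity)]
  have hπ := Real.pi_pos
  have hZ : volume.real (Metric.closedBall y r) * Real.exp (-(β * g w + Real.log 2)) ≤
      ∫ x in K, Real.exp (-β * g x) := by
    calc volume.real (Metric.closedBall y r) * Real.exp (-(β * g w + Real.log 2))
        = ∫ _ in Metric.closedBall y r, Real.exp (-(β * g w + Real.log 2)) := by
          rw [setIntegral_const, smul_eq_mul]
      _ ≤ ∫ x in Metric.closedBall y r, Real.exp (-β * g x) :=
          setIntegral_mono_on (integrableOn_const measure_closedBall_lt_top.ne)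
            (hexp.mono_set hsub) Metric.isClosed_closedBall.measurableSet hg
      _ ≤ ∫ x in K, Real.exp (-β * g x) :=
          setIntegral_mono_set hexp (Filter.Eventually.of_forall fun _ => (Real.exp_pos _).le)
            hsub.eventuallyLE
  have hv0 : 0 < volume.real (Metric.closedBall y r) := by
    rw [hvol]
    positivity
  have hlog := Real.log_le_log (by positivity) hZ
  rw [Real.log_mul hv0.ne' (Real.exp_pos _).ne', Real.log_exp, hvol,
    Real.log_mul (by positivity) (by positivity), Real.log_div (by positivity) hΓ.ne',
    Real.log_pow, Real.log_pow, Real.log_sqrt hπ.le] at hlog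
  have := log_Gamma_half_add_one_le hn
  linarith

theorem StronglyConvexOutsideBall.integral_gibbsMeasure_add_log_partition_le
    (hconv : StronglyConvexOutsideBall K μ R g)
    (hℓ : 0 < ℓ) (hμ : 0 < μ) (hR : 0 < R) (hβ : 0 < β) (hd : Differentiable ℝ g)
    (hl : ∀ x y, ‖gradient g x - gradient g y‖ ≤ ℓ * ‖x - y‖)
    (hK : Convex ℝ K) (hKm : MeasurableSet K) (h0 : 0 ∈ K) [NeZero (volume.restrict K)]
    (w : EuclideanSpace ℝ (Fin n)) {a : ℝ} (ha : 0 < a) :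
    β * ∫ x, g x ∂(gibbsMeasure K β g) + Real.log (∫ x in K, Real.exp (-β * g x))
      ≤ a * ∫ x, ‖x - w‖ ^ 2 ∂(gibbsMeasure K β g) + n / 2 * Real.log (Real.pi / a) := by
  have hexp := hconv.integrableOn_exp hℓ hμ hR hβ hd hl hK hKm h0
  have hgi := hconv.integrable_gibbsMeasure hℓ hμ hR hβ hd hl hK hKm h0 hd.continuous
    (abs_le_quadratic_of_lipschitz_gradient hℓ hd hl)
  have hS := hconv.integrable_gibbsMeasure hℓ hμ hR hβ hd hl hK hKm h0
    (H := fun y => ‖y - w‖ ^ 2) (by fun_prop) (norm_sub_sq_le_quadratic w)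
  have hψ : Integrable fun x : EuclideanSpace ℝ (Fin n) => Real.exp (-a * ‖x - w‖ ^ 2) :=
    (integrable_exp_neg_mul_norm_sq ha).comp_sub_right w
  have hEq : ∀ x, -a * ‖x - w‖ ^ 2 - -β * g x = β * g x - a * ‖x - w‖ ^ 2 := fun x => by ring
  have hI := (hgi.const_mul β).sub (hS.const_mul a)
  have key := integral_sub_tilted_le_log_sub_log hexp hψ.integrableOn
    (by simp_rw [hEq]; exact hI)
  simp_rw [hEq] at key
  have h1 : ∫ x, (β * g x - a * ‖x - w‖ ^ 2) ∂(gibbsMeasure K β g) =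
      β * ∫ x, g x ∂(gibbsMeasure K β g) - a * ∫ x, ‖x - w‖ ^ 2 ∂(gibbsMeasure K β g) := by
    rw [integral_sub (hgi.const_mul β) (hS.const_mul a), integral_const_mul, integral_const_mul]
  have h2 : ∫ x in K, Real.exp (-a * ‖x - w‖ ^ 2) ≤ (Real.pi / a) ^ ((n : ℝ) / 2) := by
    refine (setIntegral_le_integral hψ
      (Filter.Eventually.of_forall fun _ => (Real.exp_pos _).le)).trans_eq ?_
    rw [integral_sub_right_eq_self (fun x => Real.exp (-a * ‖x‖ ^ 2)) w,
      integral_exp_neg_mul_norm_sq ha]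
  have h3 := Real.log_le_log (integral_exp_pos hψ.integrableOn) h2
  rw [Real.log_rpow (div_pos Real.pi_pos ha)] at h3
  change ∫ x, (β * g x - a * ‖x - w‖ ^ 2) ∂(gibbsMeasure K β g) ≤ _ at key
  linarith

theorem StronglyConvexOutsideBall.integral_gibbsMeasure_lt (hn : 1 ≤ n)
    (hconv : StronglyConvexOutsideBall K μ R g)
    (hℓ : 0 < ℓ) (hμ : 0 < μ) (hR : 0 < R) (hβ : 0 < β) (hd : Differentiable ℝ g)
    (hl : ∀ x y, ‖gradient g x - gradient g y‖ ≤ ℓ * ‖x - y‖)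
    (hK : Convex ℝ K) (hKm : MeasurableSet K) (h0 : 0 ∈ K) [NeZero (volume.restrict K)]
    {w : EuclideanSpace ℝ (Fin n)} (hw : w ∈ K) (hmin : IsMinOn g K w) {r : ℝ}
    (hr : IsUniformChebyshevBound K (localRadius ℓ μ R β g) r) :
    ∫ x, g x ∂(gibbsMeasure K β g) < g w + n / β * suboptConst ℓ μ R β r g := by
  have hn' : (1 : ℝ) ≤ n := by exact_mod_cast hn
  have hlog3 : 0 < Real.log 3 := Real.log_pos (by norm_num)
  obtain ⟨hr0, hrK⟩ := hr
  -- The Chebyshev supremum need not be known to be attained, so the radius is shrunk by the factor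
  -- `3 ^ (-1 / 12)`. This costs half of the term `1 / 6 * log 3`; the other half makes the final
  -- inequality strict.
  have hs0 : 0 < r * Real.exp (-(1 / 12 * Real.log 3)) := mul_pos hr0 (Real.exp_pos _)
  have hs : r * Real.exp (-(1 / 12 * Real.log 3)) < r :=
    mul_lt_of_lt_one_right hr0 ((Real.exp_lt_exp.2 (by linarith)).trans_eq Real.exp_zero)
  obtain ⟨r', y, hr', hball⟩ :=
    exists_closedBall_subset_of_lt_chebyshevRadius hs0 (hs.trans_le (hrK w hw))
  have hlogr := Real.log_lt_log hs0 hr'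
  rw [Real.log_mul hr0.ne' (Real.exp_pos _).ne', Real.log_exp] at hlogr
  have hZ := hconv.log_partition_ge hn hℓ hμ hR hβ hd hl hK hKm h0 hw hmin (hs0.trans hr') hball
  set t := 1 / μ * lyapunovConst ℓ μ R β g with ht
  set S := ∫ x, ‖x - w‖ ^ 2 ∂(gibbsMeasure K β g) with hSdef
  have hSt : S ≤ t := by
    have h1 := hconv.integral_norm_sub_sq_le hℓ hμ hR hβ hd hl hK hKm h0 hw hmin
    have h2 : 0 ≤ R * ‖gradient g 0‖ := by positivity
    rw [ht, one_div, ← div_eq_inv_mul, le_div_iff₀ hμ, lyapunovConst]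
    linarith
  have hS0 : 0 ≤ S := integral_nonneg fun _ => sq_nonneg _
  have ht1 : 0 < 1 + t := by linarith
  -- The Gaussian parameter `a = 1 / (1 + t)` makes the moment term at most `t / (1 + t) ≤ log (1 +
  -- t)`.
  have hJ := hconv.integral_gibbsMeasure_add_log_partition_le hℓ hμ hR hβ hd hl hK hKm h0 w
    (inv_pos.2 ht1)
  rw [← hSdef, div_inv_eq_mul, Real.log_mul Real.pi_pos.ne' ht1.ne'] at hJ
  have h1 : (1 + t)⁻¹ * S ≤ Real.log (1 + t) := by
    have h2 := Real.one_sub_inv_le_log_of_pos ht1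
    have h3 := mul_le_mul_of_nonneg_left hSt (inv_pos.2 ht1).le
    have h4 : (1 + t)⁻¹ * t = 1 - (1 + t)⁻¹ := by
      field_simp
      ring
    linarith
  have hlogt : 0 ≤ Real.log (1 + t) := Real.log_nonneg (by linarith)
  have hlog2 : Real.log 2 ≤ Real.log (2 * Real.sqrt Real.pi) := by
    refine Real.log_le_log two_pos ?_
    have : 1 ≤ Real.sqrt Real.pi := Real.one_le_sqrt.2 (by linarith [Real.pi_gt_three])
    linarith
  have hlog2' : 0 < Real.log 2 := Real.log_pos one_lt_two
  have h5 : (n : ℝ) * (Real.log r + -(1 / 12 * Real.log 3)) ≤ n * Real.log r' :=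
    mul_le_mul_of_nonneg_left hlogr.le (by positivity)
  have h6 : Real.log (1 + t) ≤ n * Real.log (1 + t) := le_mul_of_one_le_left hlogt hn'
  have h7 : Real.log 2 ≤ n * Real.log (2 * Real.sqrt Real.pi) :=
    hlog2.trans (le_mul_of_one_le_left (by linarith) hn')
  have h8 : 0 < n * Real.log 3 := by positivity
  have h9 : 0 ≤ n * Real.log (1 + t) := by positivity
  -- The `log π` terms cancel. The moment and normalisation terms total at most `(3 / 2) n log (1 +
  -- t)`, within the allotted `2 n log (1 + t)`, and `log 2` is covered by `n log (2 √π)`.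
  have h10 : β * ∫ x, g x ∂(gibbsMeasure K β g) < β * g w + n * suboptConst ℓ μ R β r g := by
    unfold suboptConst
    rw [← ht]
    linarith
  refine lt_of_mul_lt_mul_left (h10.trans_eq ?_) hβ.le
  field_simp

end GibbsEstimates

/-! ### The suboptimality bound for the averaged objective. -/

theorem mainTheorem8 {n : ℕ} (hn : 1 ≤ n)
    {Ω Z : Type*} [MeasurableSpace Ω] (P : Measure Ω) [IsProbabilityMeasure P] (z : Ω → Z)
    (f : EuclideanSpace ℝ (Fin n) → Z → ℝ)
    (K : Set (EuclideanSpace ℝ (Fin n))) (hK : IsPolyhedron K) (hK0 : 0 ∈ interior K)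
    (ℓ μ R β ς : ℝ) (hℓ : 0 < ℓ) (hμ : 0 < μ) (hR : 0 < R) (hβ : 0 < β) (hς : 0 ≤ ς)
    (hdiff : ∀ s : Z, Differentiable ℝ (fun x => f x s))
    (hlip : ∀ (s : Z) (x₁ x₂ : EuclideanSpace ℝ (Fin n)),
      ‖gradient (fun x => f x s) x₁ - gradient (fun x => f x s) x₂‖ ≤ ℓ * ‖x₁ - x₂‖)
    (hint : ∀ x, Integrable (fun ω => f x (z ω)) P)
    (hconv : StronglyConvexOutsideBall K μ R (averagedObjective P z f)) :
    IsProbabilityMeasure (gibbsMeasure K β (averagedObjective P z f)) ∧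
    Integrable (averagedObjective P z f) (gibbsMeasure K β (averagedObjective P z f)) ∧
    (∃ r, IsUniformChebyshevBound K (localRadius ℓ μ R β (averagedObjective P z f)) r) ∧
    ∃ xmin ∈ K, IsMinOn (averagedObjective P z f) K xmin ∧
      ∀ rmin, IsUniformChebyshevBound K (localRadius ℓ μ R β (averagedObjective P z f)) rmin →
        0 < suboptConst ℓ μ R β rmin (averagedObjective P z f) ∧
        ∫ x, averagedObjective P z f x ∂(gibbsMeasure K β (averagedObjective P z f)) ≤
          averagedObjective P z f xmin +
            n / β * (2 * max 0 (Real.log ς)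
              + suboptConst ℓ μ R β rmin (averagedObjective P z f)) := by
  have hd : Differentiable ℝ (averagedObjective P z f) := fun x =>
    (hasGradientAt_averagedObjective hdiff hlip hint x).differentiableAt
  have hl := lipschitz_gradient_averagedObjective hdiff hlip hint
  set g := averagedObjective P z f
  have hKc := hK.convex
  have hKm := hK.isClosed.measurableSet
  have h0 : 0 ∈ K := interior_subset hK0
  have hne : NeZero (volume.restrict K) :=
    ⟨Measure.restrict_eq_zero.not.2 (Measure.measure_pos_of_nonempty_interior _ ⟨0, hK0⟩).ne'⟩
  have hprob : IsProbabilityMeasure (gibbsMeasure K β g) :=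
    isProbabilityMeasure_tilted (hconv.integrableOn_exp hℓ hμ hR hβ hd hl hKc hKm h0)
  have hgi : Integrable g (gibbsMeasure K β g) :=
    hconv.integrable_gibbsMeasure hℓ hμ hR hβ hd hl hKc hKm h0 hd.continuous
      (abs_le_quadratic_of_lipschitz_gradient hℓ hd hl)
  obtain ⟨w, hw, hmin⟩ := hconv.exists_isMinOn hℓ hμ hR hd hl hKc hK.isClosed h0
  refine ⟨hprob, hgi, hK.exists_isUniformChebyshevBound hn hK0 (localRadius_pos hℓ hR hβ),
    w, hw, hmin, fun r hr => ?_⟩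
  have hlt := hconv.integral_gibbsMeasure_lt hn hℓ hμ hR hβ hd hl hKc hKm h0 hw hmin hr
  have hge : g w ≤ ∫ x, g x ∂(gibbsMeasure K β g) := by
    have h := integral_mono_ae (integrable_const (g w)) hgi
      ((ae_mem_gibbsMeasure hKm).mono fun x hx => isMinOn_iff.1 hmin x hx)
    simpa using h
  have hnβ : 0 < (n : ℝ) / β := div_pos (by exact_mod_cast hn) hβ
  -- Positivity of the constant needs no numerical estimate: the mean of `g` is at least `g w` and
  -- strictly below `g w` plus `n / β` times the constant.
  refine ⟨pos_of_mul_pos_right (a := (n : ℝ) / β) (by linarith) hnβ.le, hlt.le.trans ?_⟩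
  have : 0 ≤ n / β * (2 * max 0 (Real.log ς)) :=
    mul_nonneg hnβ.le (mul_nonneg two_pos.le (le_max_left _ _))
  linarith
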